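/- Let $\mathbb D$ be the space of right-continuous functions $x:[0,1]\to\mathbb R$ with left limits, let $\|x\|=\sup_{s\in[0,1]}|x(s)|$, let $\Lambda$ be the set of strictly increasing continuous functions from $[0,1]$ onto $[0,1]$, let $e$ be the identity of $[0,1]$, and equip $\mathbb D$ with the Skorohod ($J_1$) distance $$d^0_{J_1}(x,y)=\inf_{\lambda\in\Lambda}\bigl\{\|\lambda\|^0\vee\|x-y\circ\lambda\|\bigr\},\qquad \|\lambda\|^0=\sup_{s<s'}\Bigl|\log\frac{\lambda(s')-\lambda(s)}{s'-s}\Bigr| .$$ Let $\mathbb D([0,1];\mathbb D)$ be the space of functions $x:[0,1]\to\mathbb D$ which are right-continuous and have left limits with respect to $d^0_{J_1}$, equipped with the distance $$d_{\mathbb D}(x,y)=\inf_{\lambda\in\Lambda}\Bigl\{\|\lambda-e\|\vee\sup_{t\in[0,1]}d^0_{J_1}\bigl(x(t),y(\lambda(t))\bigr)\Bigr\},\qquad \|\lambda-e\|=\sup_{t\in[0,1]}|\lambda(t)-t| ,$$ and let $\|x\|_{\mathbb D}=\sup_{t\in[0,1]}\|x(t)\|$. For $\delta\in(0,1)$, a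 set $\{t_i\}_{0\le i\le v}$ with $0=t_0<t_1<\dots<t_v=1$ is called $\delta$-sparse if $\min_{1\le i\le v}(t_i-t_{i-1})>\delta$. For $x\in\mathbb D$, respectively $x\in\mathbb D([0,1];\mathbb D)$, put $$w'(x,\delta)=\inf_{\{t_i\}}\max_{1\le i\le v}\ \sup_{s_1,s_2\in[t_{i-1},t_i)}|x(s_1)-x(s_2)|,\qquad w'_{\mathbb D}(x,\delta)=\inf_{\{t_i\}}\max_{1\le i\le v}\ \sup_{s_1,s_2\in[t_{i-1},t_i)}d^0_{J_1}\bigl(x(s_1),x(s_2)\bigr),$$ where the infima are over all $\delta$-sparse sets. **Theorem.** A set $A\subset\mathbb D([0,1];\mathbb D)$ is relatively compact with respect to $d_{\mathbb D}$ (that is, its closure in $\mathbb D([0,1];\mathbb D)$ is compact) if and only if the following three conditions hold: (i) $\sup_{x\in A}\|x\|_{\mathbb D}<\infty$; (ii) $\lim_{\delta\to0}\sup_{x\in A}\sup_{t\in[0,1]}w'(x(t),\delta)=0$; (iii) $\lim_{\delta\to0}\sup_{x\in A}w'_{\mathbb D}(x,\delta)=0$. (Suprema are taken in $[0,\infty]$,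 with $\sup\emptyset=0$.) -/

import Mathlib

open Set Filter Topology
open scoped ENNReal unitInterval

noncomputable section

namespace Skorohod

/-- Functions `x : [0,1] → S` that are right-continuous on `[0,1)` and have left limits in `S` on
`(0,1]`.  (Right-continuity at `1` is vacuous.) -/
structure Cadlag (S : Type*) [TopologicalSpace S] where
  toFun : I → S
  right_cont : ∀ t : I, ContinuousWithinAt toFun (Ici t) t
  left_lim : ∀ t : I, 0 < t → ∃ l : S, Tendsto toFun (𝓝[<] t) (𝓝 l)

instance {S : Type*} [TopologicalSpace S] : CoeFun (Cadlag S) (fun _ => I → S) := ⟨Cadlag.toFun⟩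

/-- The set `Λ` of time changes: strictly increasing continuous functions from `[0,1]` onto
`[0,1]`, bundled as order isomorphisms (see `isTimeChange_iff`). -/
abbrev TimeChange := I ≃o I

theorem isTimeChange_iff (f : I → I) :
    (StrictMono f ∧ Continuous f ∧ Function.Surjective f) ↔ ∃ e : TimeChange, ⇑e = f := by
  constructor
  · rintro ⟨hm, -, hs⟩
    exact ⟨hm.orderIsoOfSurjective f hs, rfl⟩
  · rintro ⟨e, rfl⟩
    exact ⟨e.strictMono, e.continuous, e.surjective⟩

/-- `‖μ - e‖ = sup_t |μ(t) - t|`. -/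
def dispNorm (μ : TimeChange) : ℝ≥0∞ :=
  ⨆ t : I, ENNReal.ofReal |(μ t : ℝ) - (t : ℝ)|

/-- `‖μ‖⁰ = sup_{s<s'} |log ((μ(s') - μ(s)) / (s' - s))|`, possibly infinite. -/
def logNorm (μ : TimeChange) : ℝ≥0∞ :=
  ⨆ (s : I) (s' : I) (_ : s < s'),
    ENNReal.ofReal |Real.log (((μ s' : ℝ) - (μ s : ℝ)) / ((s' : ℝ) - (s : ℝ)))|

/-- The uniform distance `sup_t d(x(t), y(t))` between functions with values in `S`. -/
def unifDist {S : Type*} [PseudoEMetricSpace S] (x y : I → S) : ℝ≥0∞ :=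
  ⨆ t : I, edist (x t) (y t)

/-- `inf_μ ( N(μ) ∨ sup_t d(x(t), y(μ(t))) )`, the infimum over all time changes, for a given way
`N` of measuring the size of a time change. -/
def timeChangeDist (N : TimeChange → ℝ≥0∞) {S : Type*} [PseudoEMetricSpace S]
    (x y : I → S) : ℝ≥0∞ :=
  ⨅ μ : TimeChange, max (N μ) (unifDist x (y ∘ μ))

section helpers

theorem dispNorm_refl : dispNorm (OrderIso.refl I) = 0 := by
  simp [dispNorm]

theorem dispNorm_symm_le (μ : TimeChange) : dispNorm μ.symm ≤ dispNorm μ := by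
  refine iSup_le fun t => ?_
  refine le_trans (le_of_eq ?_) (le_iSup _ (μ.symm t))
  rw [OrderIso.apply_symm_apply, abs_sub_comm]

theorem dispNorm_trans_le (μ ν : TimeChange) :
    dispNorm (μ.trans ν) ≤ dispNorm μ + dispNorm ν := by
  refine iSup_le fun t => ?_
  have h1 : ENNReal.ofReal |(μ t : ℝ) - (t : ℝ)| ≤ dispNorm μ :=
    le_iSup (fun t : I => ENNReal.ofReal |(μ t : ℝ) - (t : ℝ)|) t
  have h2 : ENNReal.ofReal |(ν (μ t) : ℝ) - (μ t : ℝ)| ≤ dispNorm ν :=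
    le_iSup (fun t : I => ENNReal.ofReal |(ν t : ℝ) - (t : ℝ)|) (μ t)
  refine le_trans ?_ (add_le_add h1 h2)
  rw [← ENNReal.ofReal_add (abs_nonneg _) (abs_nonneg _), add_comm]
  exact ENNReal.ofReal_le_ofReal (abs_sub_le _ _ _)

theorem le_logNorm (μ : TimeChange) {s s' : I} (h : s < s') :
    ENNReal.ofReal |Real.log (((μ s' : ℝ) - (μ s : ℝ)) / ((s' : ℝ) - (s : ℝ)))| ≤ logNorm μ :=
  le_iSup_of_le s (le_iSup_of_le s' (le_iSup_of_le h le_rfl))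

theorem logNorm_refl : logNorm (OrderIso.refl I) = 0 := by
  refine le_antisymm (iSup_le fun s => iSup_le fun s' => iSup_le fun h => ?_) (zero_le)
  have : (0 : ℝ) < (s' : ℝ) - (s : ℝ) := sub_pos.2 h
  simp [div_self this.ne']

theorem logNorm_symm_le (μ : TimeChange) : logNorm μ.symm ≤ logNorm μ := by
  refine iSup_le fun s => iSup_le fun s' => iSup_le fun h => ?_
  refine le_trans (le_of_eq ?_) (le_logNorm μ (μ.symm.strictMono h))
  rw [OrderIso.apply_symm_apply, OrderIso.apply_symm_apply, ← inv_div, Real.log_inv, abs_neg]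

theorem logNorm_trans_le (μ ν : TimeChange) :
    logNorm (μ.trans ν) ≤ logNorm μ + logNorm ν := by
  refine iSup_le fun s => iSup_le fun s' => iSup_le fun h => ?_
  have h0 : (0 : ℝ) < (s' : ℝ) - (s : ℝ) := sub_pos.2 h
  have h1 : (0 : ℝ) < (μ s' : ℝ) - (μ s : ℝ) := sub_pos.2 (μ.strictMono h)
  have h2 : (0 : ℝ) < (ν (μ s') : ℝ) - (ν (μ s) : ℝ) :=
    sub_pos.2 (ν.strictMono (μ.strictMono h))
  refine le_trans ?_ (add_le_add (le_logNorm μ h) (le_logNorm ν (μ.strictMono h)))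
  rw [← ENNReal.ofReal_add (abs_nonneg _) (abs_nonneg _)]
  refine ENNReal.ofReal_le_ofReal ?_
  refine le_trans (le_of_eq ?_) (abs_add_le _ _)
  rw [← Real.log_mul (div_pos h1 h0).ne' (div_pos h2 h1).ne']
  congr 2
  simp only [OrderIso.trans_apply]
  field_simp

variable {N : TimeChange → ℝ≥0∞} {S : Type*} [PseudoEMetricSpace S]

theorem timeChangeDist_self (h : N (OrderIso.refl I) = 0) (x : I → S) :
    timeChangeDist N x x = 0 := by
  refine le_antisymm (iInf_le_of_le (OrderIso.refl I) ?_) zero_le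
  simp [h, unifDist]

theorem timeChangeDist_comm_le (h : ∀ μ, N μ.symm ≤ N μ) (x y : I → S) :
    timeChangeDist N x y ≤ timeChangeDist N y x := by
  refine le_iInf fun μ => iInf_le_of_le μ.symm (max_le_max (h μ) ?_)
  refine iSup_le fun t => le_trans (le_of_eq ?_)
    (le_iSup (fun t => edist (y t) ((x ∘ μ) t)) (μ.symm t))
  simp [edist_comm]

theorem timeChangeDist_triangle (h : ∀ μ ν, N (μ.trans ν) ≤ N μ + N ν) (x y z : I → S) :
    timeChangeDist N x z ≤ timeChangeDist N x y + timeChangeDist N y z := by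
  unfold timeChangeDist
  rw [ENNReal.iInf_add]
  refine le_iInf fun μ => ?_
  rw [ENNReal.add_iInf]
  refine le_iInf fun ν => iInf_le_of_le (μ.trans ν) (max_le ?_ ?_)
  · exact (h μ ν).trans (add_le_add (le_max_left _ _) (le_max_left _ _))
  · refine le_trans (iSup_le fun t => ?_) (add_le_add (le_max_right _ _) (le_max_right _ _))
    exact (edist_triangle _ (y (μ t)) _).trans (add_le_add
      (le_iSup (fun t => edist (x t) ((y ∘ μ) t)) t)
      (le_iSup (fun t => edist (y t) ((z ∘ ν) t)) (μ t)))

end helpers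

/-- The space `𝔻` of real càdlàg functions on `[0,1]`. -/
abbrev D := Cadlag ℝ

/-- `𝔻` with the Skorohod distance `d⁰_{J₁}(x,y) = inf_μ ( ‖μ‖⁰ ∨ ‖x - y ∘ μ‖ )`, which induces the
`J₁` topology. -/
instance : PseudoEMetricSpace D where
  edist x y := timeChangeDist logNorm x y
  edist_self x := timeChangeDist_self logNorm_refl x
  edist_comm x y := le_antisymm (timeChangeDist_comm_le logNorm_symm_le x y)
    (timeChangeDist_comm_le logNorm_symm_le y x)
  edist_triangle x y z := timeChangeDist_triangle logNorm_trans_le x y z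

/-- The space `𝔻([0,1];𝔻)` of functions on `[0,1]` with values in `𝔻`, right-continuous and with
left limits with respect to `J₁`. -/
abbrev DD := Cadlag D

/-- `𝔻([0,1];𝔻)` with the Skorohod distance `d_𝔻(x,y) = inf_μ ( ‖μ - e‖ ∨ ρ_𝔻(x, y ∘ μ) )`, where
`ρ_𝔻(x,y) = sup_t d⁰_{J₁}(x(t),y(t))`. -/
instance : PseudoEMetricSpace DD where
  edist x y := timeChangeDist dispNorm x y
  edist_self x := timeChangeDist_self dispNorm_refl x
  edist_comm x y := le_antisymm (timeChangeDist_comm_le dispNorm_symm_le x y)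
    (timeChangeDist_comm_le dispNorm_symm_le y x)
  edist_triangle x y z := timeChangeDist_triangle dispNorm_trans_le x y z

/-- The supremum norm `‖x‖ = sup_s |x(s)|` on `𝔻`. -/
def supNorm (x : D) : ℝ≥0∞ := ⨆ s : I, ENNReal.ofReal |x s|

/-- The super-uniform norm `‖x‖_𝔻 = sup_t ‖x(t)‖` on `𝔻([0,1];𝔻)`. -/
def superNorm (x : DD) : ℝ≥0∞ := ⨆ t : I, supNorm (x t)

/-- A partition `0 = t₀ < t₁ < ⋯ < t_v = 1` with `min_i (t_i - t_{i-1}) > δ`. -/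
structure IsSparse (δ : ℝ) {v : ℕ} (t : Fin (v + 1) → I) : Prop where
  zero : t 0 = 0
  last : t (Fin.last v) = 1
  strictMono : StrictMono t
  gap : ∀ i : Fin v, δ < (t i.succ : ℝ) - (t i.castSucc : ℝ)

variable {S : Type*} [PseudoEMetricSpace S]

/-- The oscillation `w(x,T) = sup_{t₁,t₂ ∈ T} d(x(t₁), x(t₂))`.  For `S = ℝ` the distance is
`|x(t₁) - x(t₂)|`; for `S = 𝔻` it is `d⁰_{J₁}`, and this is `w_𝔻(x,T)`. -/
def osc (x : I → S) (T : Set I) : ℝ≥0∞ :=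
  ⨆ t₁ ∈ T, ⨆ t₂ ∈ T, edist (x t₁) (x t₂)

/-- The càdlàg modulus `inf_{t_i} max_{1 ≤ i ≤ v} w(x, [t_{i-1}, t_i))`, the infimum over all
`δ`-sparse sets.  For `S = ℝ` this is `w'(x,δ)`; for `S = 𝔻` it is `w'_𝔻(x,δ)`. -/
def modulus (x : I → S) (δ : ℝ) : ℝ≥0∞ :=
  ⨅ (v : ℕ) (t : Fin (v + 1) → I) (_ : IsSparse δ t),
    ⨆ i : Fin v, osc x (Ico (t i.castSucc) (t i.succ))

end Skorohod

end

namespace Skorohod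

/-! ### Time changes: slopes and displacements -/

section TimeChanges

/-! Both layers of the space are handled by one argument for càdlàg functions with values in an
arbitrary `S`, with time changes measured by `logNorm`. For complete `S` this distance is complete:
bounds on slopes survive infinite composition, so time changes do not degenerate in the limit. A set
is totally bounded for it once its values form a totally bounded set and its moduli are uniformly
small (`totallyBounded_logCadlag`): sparse partition points can be moved to a fixed grid with slopes
close to 1, leaving finitely many step functions.

Sufficiency uses this twice. For `S = ℝ`, (i) and (ii) make the set of all values `x t` totally
bounded in `D`, and `D` is complete. For `S = D`, (iii) then makes `A` relatively compact for the
log-norm distance. The identity into `DD` is uniformly continuous, because a small log norm forces a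
small displacement, so compactness passes to `d_𝔻`, although `d_𝔻` itself is not complete.

Necessity: a càdlàg function has totally bounded range, so the values of a totally bounded `A` form
a totally bounded set. Comparison with a finite net gives (i) and (ii). For (iii) the moduli are
controlled near each point of the compact closure, and finitely many neighbourhoods suffice. -/

theorem timeChange_zero (μ : TimeChange) : μ 0 = 0 := μ.map_bot

theorem timeChange_one (μ : TimeChange) : μ 1 = 1 := μ.map_top

theorem slope_bounds_of_logNorm_le {μ : TimeChange} {c : ℝ} (hc : 0 ≤ c)
    (h : logNorm μ ≤ ENNReal.ofReal c) {s s' : I} (hs : s ≤ s') :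
    Real.exp (-c) * ((s' : ℝ) - s) ≤ (μ s' : ℝ) - μ s ∧
      (μ s' : ℝ) - μ s ≤ Real.exp c * ((s' : ℝ) - s) := by
  rcases hs.eq_or_lt with rfl | hs
  · simp
  have h0 : (0 : ℝ) < (s' : ℝ) - (s : ℝ) := sub_pos.2 hs
  have h1 : (0 : ℝ) < (μ s' : ℝ) - (μ s : ℝ) := sub_pos.2 (μ.strictMono hs)
  have h2 := (ENNReal.ofReal_le_ofReal_iff hc).1 ((le_logNorm μ hs).trans h)
  obtain ⟨h3, h4⟩ := abs_le.1 h2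
  rw [Real.le_log_iff_exp_le (div_pos h1 h0), le_div_iff₀ h0] at h3
  rw [Real.log_le_iff_le_exp (div_pos h1 h0), div_le_iff₀ h0] at h4
  exact ⟨h3, h4⟩

theorem logNorm_le_of_slope_bounds {μ : TimeChange} {c : ℝ}
    (h : ∀ s s' : I, s ≤ s' → Real.exp (-c) * ((s' : ℝ) - s) ≤ (μ s' : ℝ) - μ s ∧
      (μ s' : ℝ) - μ s ≤ Real.exp c * ((s' : ℝ) - s)) :
    logNorm μ ≤ ENNReal.ofReal c := by
  refine iSup_le fun s => iSup_le fun s' => iSup_le fun hs => ENNReal.ofReal_le_ofReal ?_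
  have h0 : (0 : ℝ) < (s' : ℝ) - (s : ℝ) := sub_pos.2 hs
  have h1 : (0 : ℝ) < (μ s' : ℝ) - (μ s : ℝ) := sub_pos.2 (μ.strictMono hs)
  obtain ⟨h3, h4⟩ := h s s' hs.le
  rw [abs_le, Real.le_log_iff_exp_le (div_pos h1 h0), le_div_iff₀ h0,
    Real.log_le_iff_le_exp (div_pos h1 h0), div_le_iff₀ h0]
  exact ⟨h3, h4⟩

/-- A self-map of `[0,1]` fixing the end points and with slopes in `[e⁻ᶜ, eᶜ]` is a time change. -/
theorem exists_timeChange_of_slope_bounds (g : I → I) (c : ℝ) (h0 : g 0 = 0) (h1 : g 1 = 1)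
    (h : ∀ s s' : I, s ≤ s' → Real.exp (-c) * ((s' : ℝ) - s) ≤ (g s' : ℝ) - g s ∧
      (g s' : ℝ) - g s ≤ Real.exp c * ((s' : ℝ) - s)) :
    ∃ μ : TimeChange, ⇑μ = g ∧ logNorm μ ≤ ENNReal.ofReal c := by
  have hm : StrictMono g := fun s s' hs => by
    have h2 : (0 : ℝ) < (s' : ℝ) - (s : ℝ) := sub_pos.2 hs
    have := mul_pos (Real.exp_pos (-c)) h2
    exact_mod_cast sub_pos.1 (this.trans_le (h s s' hs.le).1)
  have hl : LipschitzWith (Real.exp c).toNNReal g := by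
    refine LipschitzWith.of_dist_le_mul fun s s' => ?_
    rw [Real.coe_toNNReal _ (Real.exp_pos c).le, Subtype.dist_eq, Subtype.dist_eq,
      Real.dist_eq, Real.dist_eq]
    rcases le_total s s' with hs | hs
    · rw [abs_sub_comm, abs_of_nonneg (sub_nonneg.2 (Subtype.coe_le_coe.2 (hm.monotone hs))), abs_sub_comm,
        abs_of_nonneg (sub_nonneg.2 (Subtype.coe_le_coe.2 hs))]
      exact (h s s' hs).2
    · rw [abs_of_nonneg (sub_nonneg.2 (Subtype.coe_le_coe.2 (hm.monotone hs))),
        abs_of_nonneg (sub_nonneg.2 (Subtype.coe_le_coe.2 hs))]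
      exact (h s' s hs).2
  have hsurj : Function.Surjective g := fun y =>
    mem_range_of_exists_le_of_exists_ge hl.continuous
      ⟨0, h0.le.trans unitInterval.nonneg'⟩ ⟨1, unitInterval.le_one'.trans h1.ge⟩
  refine ⟨hm.orderIsoOfSurjective g hsurj, rfl, logNorm_le_of_slope_bounds h⟩

theorem abs_sub_le_of_logNorm_le {μ : TimeChange} {c : ℝ} (hc : 0 ≤ c)
    (h : logNorm μ ≤ ENNReal.ofReal c) (t : I) :
    |(μ t : ℝ) - t| ≤ Real.exp c - 1 := by
  obtain ⟨h1, h2⟩ := slope_bounds_of_logNorm_le hc h (unitInterval.nonneg' (t := t))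
  have h0 : ((μ 0 : I) : ℝ) = 0 := by
    rw [timeChange_zero]; rfl
  simp only [h0, Set.Icc.coe_zero, sub_zero] at h1 h2
  have ht0 := t.2.1
  have ht1 := t.2.2
  have e1 : 1 ≤ Real.exp c := Real.one_le_exp hc
  have e2 : 1 - Real.exp (-c) ≤ Real.exp c - 1 := by
    have := Real.add_one_le_exp c
    have := Real.add_one_le_exp (-c)
    linarith
  rw [abs_le]
  constructor
  · nlinarith
  · nlinarith

theorem dispNorm_le_of_logNorm_le {μ : TimeChange} {c : ℝ} (hc : 0 ≤ c)
    (h : logNorm μ ≤ ENNReal.ofReal c) : dispNorm μ ≤ ENNReal.ofReal (Real.exp c - 1) :=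
  iSup_le fun t => ENNReal.ofReal_le_ofReal (abs_sub_le_of_logNorm_le hc h t)

theorem abs_sub_le_of_dispNorm_le {μ : TimeChange} {c : ℝ} (hc : 0 ≤ c)
    (h : dispNorm μ ≤ ENNReal.ofReal c) (t : I) : |(μ t : ℝ) - t| ≤ c :=
  (ENNReal.ofReal_le_ofReal_iff hc).1
    ((le_iSup (fun t : I => ENNReal.ofReal |(μ t : ℝ) - (t : ℝ)|) t).trans h)

end TimeChanges

/-! ### Oscillations and moduli under time changes -/

section Distances

variable {S : Type*} [PseudoEMetricSpace S]

theorem edist_le_unifDist (x y : I → S) (t : I) : edist (x t) (y t) ≤ unifDist x y :=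
  le_iSup (fun t => edist (x t) (y t)) t

theorem timeChangeDist_lt_iff {N : TimeChange → ℝ≥0∞} {x y : I → S} {ε : ℝ≥0∞} :
    timeChangeDist N x y < ε ↔ ∃ μ : TimeChange, N μ < ε ∧ unifDist x (y ∘ μ) < ε := by
  simp [timeChangeDist, iInf_lt_iff]

theorem edist_le_osc {x : I → S} {T : Set I} {s t : I} (hs : s ∈ T) (ht : t ∈ T) :
    edist (x s) (x t) ≤ osc x T :=
  le_iSup₂_of_le s hs (le_iSup₂_of_le t ht le_rfl)

theorem osc_le_iff {x : I → S} {T : Set I} {ε : ℝ≥0∞} :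
    osc x T ≤ ε ↔ ∀ s ∈ T, ∀ t ∈ T, edist (x s) (x t) ≤ ε := by
  simp [osc]

theorem modulus_lt_iff {x : I → S} {δ : ℝ} {ε : ℝ≥0∞} :
    modulus x δ < ε ↔ ∃ (v : ℕ) (t : Fin (v + 1) → I), IsSparse δ t ∧
      ⨆ i : Fin v, osc x (Ico (t i.castSucc) (t i.succ)) < ε := by
  simp [modulus, iInf_lt_iff]

theorem modulus_le_of_isSparse {x : I → S} {δ : ℝ} {ε : ℝ≥0∞} {v : ℕ} {t : Fin (v + 1) → I}
    (ht : IsSparse δ t) (h : ∀ i : Fin v, osc x (Ico (t i.castSucc) (t i.succ)) ≤ ε) :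
    modulus x δ ≤ ε :=
  iInf_le_of_le v (iInf_le_of_le t (iInf_le_of_le ht (iSup_le h)))

theorem modulus_mono (x : I → S) : Monotone (modulus x) := fun _ _ hδ =>
  le_iInf fun _ => le_iInf fun _ => le_iInf fun ht =>
    modulus_le_of_isSparse ⟨ht.zero, ht.last, ht.strictMono, fun i => hδ.trans_lt (ht.gap i)⟩
      fun i => le_iSup (fun _ => osc x (Ico _ _)) i

/-- Comparison of the moduli of two functions that are close after a time change. -/
theorem modulus_le_of_timeChange {x y : I → S} {δ δ' : ℝ} {η ε : ℝ≥0∞} (μ : TimeChange)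
    (hμ : ∀ s s' : I, s < s' → δ < (s' : ℝ) - s → δ' < (μ s' : ℝ) - μ s)
    (hx : modulus x δ < η) (hxy : unifDist x (y ∘ μ) ≤ ε) :
    modulus y δ' ≤ η + 2 * ε := by
  obtain ⟨v, t, ht, hosc⟩ := modulus_lt_iff.1 hx
  refine modulus_le_of_isSparse (t := fun i => μ (t i)) ⟨?_, ?_, ?_, ?_⟩
    fun i => osc_le_iff.2 fun s hs s' hs' => ?_
  · rw [ht.zero, timeChange_zero]
  · rw [ht.last, timeChange_one]
  · exact μ.strictMono.comp ht.strictMono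
  · exact fun i => hμ _ _ (ht.strictMono i.castSucc_lt_succ) (ht.gap i)
  · obtain ⟨r, rfl⟩ := μ.surjective s
    obtain ⟨r', rfl⟩ := μ.surjective s'
    have hr : r ∈ Ico (t i.castSucc) (t i.succ) :=
      ⟨μ.le_iff_le.1 hs.1, μ.lt_iff_lt.1 hs.2⟩
    have hr' : r' ∈ Ico (t i.castSucc) (t i.succ) :=
      ⟨μ.le_iff_le.1 hs'.1, μ.lt_iff_lt.1 hs'.2⟩
    have h1 : edist (x r) (x r') ≤ η := (edist_le_osc hr hr').trans
      ((le_iSup (fun i => osc x (Ico (t (Fin.castSucc i)) (t i.succ))) i).trans hosc.le)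
    have h2 : edist (x r) (y (μ r)) ≤ ε := (edist_le_unifDist x (y ∘ μ) r).trans hxy
    have h3 : edist (x r') (y (μ r')) ≤ ε := (edist_le_unifDist x (y ∘ μ) r').trans hxy
    calc edist (y (μ r)) (y (μ r'))
        ≤ edist (y (μ r)) (x r) + edist (x r) (x r') + edist (x r') (y (μ r')) :=
          edist_triangle4 _ _ _ _
      _ ≤ ε + η + ε := by
          rw [edist_comm (y (μ r))]
          exact add_le_add (add_le_add h2 h1) h3
      _ = η + 2 * ε := by ring

end Distances

/-! ### Finite partitions with small oscillation -/

section Partitions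

variable {S : Type*} [PseudoEMetricSpace S]

/-- The left limit controls `x` only strictly before `t`. Allowing every `b > a` lets `b` later be
chosen among the end points already reached by partitions. -/
theorem Cadlag.exists_osc_Ico_le_left (x : Cadlag S) {t : I} (ht : 0 < t) {ε : ℝ≥0∞} (hε : 0 < ε) :
    ∃ a < t, ∀ b, a < b → osc x (Ico b t) ≤ ε := by
  obtain ⟨l, hl⟩ := x.left_lim t ht
  have h := hl.eventually (Metric.eball_mem_nhds l (ENNReal.half_pos hε.ne'))
  obtain ⟨a, ha, hat⟩ := (mem_nhdsLT_iff_exists_Ioo_subset' ht).1 h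
  refine ⟨a, ha, fun b hb => osc_le_iff.2 fun s hs s' hs' => ?_⟩
  have h1 : edist (x s) l < ε / 2 := hat ⟨hb.trans_le hs.1, hs.2⟩
  have h2 : edist (x s') l < ε / 2 := hat ⟨hb.trans_le hs'.1, hs'.2⟩
  calc edist (x s) (x s') ≤ edist (x s) l + edist (x s') l := edist_triangle_right _ _ _
    _ ≤ ε / 2 + ε / 2 := add_le_add h1.le h2.le
    _ = ε := ENNReal.add_halves ε

theorem Cadlag.exists_osc_Ico_le_right (x : Cadlag S) {t : I} (ht : t < 1) {ε : ℝ≥0∞}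
    (hε : 0 < ε) : ∃ b > t, osc x (Ico t b) ≤ ε := by
  have h := (x.right_cont t).eventually (Metric.eball_mem_nhds (x t) (ENNReal.half_pos hε.ne'))
  obtain ⟨b, hb, hbt⟩ := (mem_nhdsGE_iff_exists_Ico_subset' ht).1 h
  refine ⟨b, hb, osc_le_iff.2 fun s hs s' hs' => ?_⟩
  have h1 : edist (x s) (x t) < ε / 2 := hbt hs
  have h2 : edist (x s') (x t) < ε / 2 := hbt hs'
  calc edist (x s) (x s') ≤ edist (x s) (x t) + edist (x s') (x t) := edist_triangle_right _ _ _
    _ ≤ ε / 2 + ε / 2 := add_le_add h1.le h2.le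
    _ = ε := ENNReal.add_halves ε

/-- `[0,b)` splits into finitely many intervals on each of which `x` oscillates by at most `ε`. -/
def HasPartition (x : I → S) (ε : ℝ≥0∞) (b : I) : Prop :=
  ∃ (v : ℕ) (t : Fin (v + 1) → I), t 0 = 0 ∧ t (Fin.last v) = b ∧ StrictMono t ∧
    ∀ i : Fin v, osc x (Ico (t i.castSucc) (t i.succ)) ≤ ε

theorem HasPartition.extend {x : I → S} {ε : ℝ≥0∞} {a b : I} (h : HasPartition x ε a)
    (hab : a < b) (hosc : osc x (Ico a b) ≤ ε) : HasPartition x ε b := by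
  obtain ⟨v, t, h0, h1, hm, ht⟩ := h
  refine ⟨v + 1, Fin.snoc t b, ?_, by simp, ?_, ?_⟩
  · rw [← Fin.castSucc_zero, Fin.snoc_castSucc, h0]
  · rw [Fin.strictMono_iff_lt_succ]
    intro i
    induction i using Fin.lastCases with
    | last => simpa [h1] using hab
    | cast i =>
      rw [Fin.succ_castSucc, Fin.snoc_castSucc, Fin.snoc_castSucc]
      exact hm i.castSucc_lt_succ
  · intro i
    induction i using Fin.lastCases with
    | last => simpa [h1] using hosc
    | cast i =>
      rw [Fin.succ_castSucc, Fin.snoc_castSucc, Fin.snoc_castSucc]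
      exact ht i

/-- The supremum `c` of the reachable end points is itself reachable because of the left limit at
`c`. If `c < 1`, right-continuity at `c` would reach beyond it. -/
theorem Cadlag.hasPartition_one (x : Cadlag S) {ε : ℝ≥0∞} (hε : 0 < ε) : HasPartition x ε 1 := by
  have hzero : HasPartition x ε 0 :=
    ⟨0, fun _ => 0, rfl, rfl, by simp [Fin.strictMono_iff_lt_succ], fun i => i.elim0⟩
  set c : I := sSup {b | HasPartition x ε b} with hc
  have hlub : IsLUB {b | HasPartition x ε b} c := isLUB_sSup _
  have hPc : HasPartition x ε c := by
    rcases (unitInterval.nonneg' (t := c)).eq_or_lt with h | h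
    · rwa [← h]
    obtain ⟨a, hac, ha⟩ := x.exists_osc_Ico_le_left h hε
    obtain ⟨b, hb, hab, hbc⟩ := hlub.exists_between hac
    rcases hbc.eq_or_lt with rfl | hbc
    · exact hb
    · exact hb.extend hbc (ha b hab)
  rcases (unitInterval.le_one' (t := c)).eq_or_lt with h | h
  · rwa [← h]
  obtain ⟨b, hb, hosc⟩ := x.exists_osc_Ico_le_right h hε
  exact absurd (hlub.1 (hPc.extend hb hosc)) (not_le.2 hb)

theorem exists_mem_Ico_of_partition {v : ℕ} {t : Fin (v + 1) → I} (h0 : t 0 = 0)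
    (h1 : t (Fin.last v) = 1) {s : I} (hs : s < 1) :
    ∃ i : Fin v, s ∈ Ico (t i.castSucc) (t i.succ) := by
  by_contra! hcon
  have : ∀ i : Fin (v + 1), t i ≤ s := by
    intro i
    induction i using Fin.induction with
    | zero => rw [h0]; exact unitInterval.nonneg'
    | succ i ih => exact not_lt.1 fun h => hcon i ⟨ih, h⟩
  exact absurd (h1 ▸ this (Fin.last v)) (not_le.2 hs)

theorem Cadlag.exists_modulus_le (x : Cadlag S) {ε : ℝ≥0∞} (hε : 0 < ε) :
    ∃ δ > 0, modulus x δ ≤ ε := by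
  obtain ⟨v, t, h0, h1, hm, ht⟩ := x.hasPartition_one hε
  have hpos : ∀ i : Fin v, (0 : ℝ) < (t i.succ : ℝ) - t i.castSucc := fun i =>
    sub_pos.2 (hm i.castSucc_lt_succ)
  obtain ⟨δ, hδ, hgap⟩ : ∃ δ > (0 : ℝ), ∀ i : Fin v, δ < (t i.succ : ℝ) - t i.castSucc := by
    have : ∀ᶠ δ in 𝓝[>] (0 : ℝ), ∀ i : Fin v, δ < (t i.succ : ℝ) - t i.castSucc :=
      eventually_all.2 fun i => nhdsWithin_le_nhds (eventually_lt_nhds (hpos i))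
    obtain ⟨δ, h⟩ := (this.and self_mem_nhdsWithin).exists
    exact ⟨δ, h.2, h.1⟩
  exact ⟨δ, hδ, modulus_le_of_isSparse ⟨h0, h1, hm, hgap⟩ ht⟩

theorem Cadlag.totallyBounded_range (x : Cadlag S) : TotallyBounded (range x) := by
  refine EMetric.totallyBounded_iff.2 fun ε hε => ?_
  obtain ⟨ε', hε', hlt⟩ := exists_between hε
  obtain ⟨v, t, h0, h1, -, ht⟩ := x.hasPartition_one hε'
  refine ⟨range (x ∘ t), finite_range _, ?_⟩
  rintro _ ⟨s, rfl⟩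
  simp only [mem_iUnion, Metric.mem_eball, exists_prop, exists_range_iff, Function.comp_apply]
  -- The half-open intervals miss the point 1, so the net must also contain the value there.
  rcases (unitInterval.le_one' (t := s)).eq_or_lt with rfl | hs
  · exact ⟨Fin.last v, by simpa [h1] using hε⟩
  · obtain ⟨i, hi⟩ := exists_mem_Ico_of_partition h0 h1 hs
    refine ⟨i.castSucc, lt_of_le_of_lt ?_ hlt⟩
    exact (edist_le_osc hi (left_mem_Ico.2 (hi.1.trans_lt hi.2))).trans (ht i)

end Partitions

/-! ### Completeness of the log-norm Skorohod distance -/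

section Completeness

variable {S : Type*} [PseudoEMetricSpace S]

/-- The composition of a càdlàg function with a time change. -/
def Cadlag.comp (x : Cadlag S) (μ : TimeChange) : Cadlag S where
  toFun := x ∘ μ
  right_cont t := (x.right_cont (μ t)).comp μ.continuous.continuousWithinAt
    fun _ hs => μ.monotone hs
  left_lim t ht := by
    obtain ⟨l, hl⟩ := x.left_lim (μ t) (by rw [← timeChange_zero μ]; exact μ.strictMono ht)
    exact ⟨l, hl.comp (tendsto_nhdsWithin_of_tendsto_nhds_of_eventually_within _
      (μ.continuous.continuousAt.mono_left nhdsWithin_le_nhds)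
      (eventually_nhdsWithin_of_forall fun s hs => μ.strictMono hs))⟩

/-- Uniform limits of càdlàg functions are càdlàg. -/
theorem exists_cadlag_of_unifDist_lt [CompleteSpace S] (f : I → S)
    (h : ∀ ε > 0, ∃ y : Cadlag S, unifDist y f < ε) : ∃ z : Cadlag S, ⇑z = f := by
  refine ⟨⟨f, fun t => ?_, fun t ht => ?_⟩, rfl⟩
  · refine continuousWithinAt_of_locally_uniform_approx_of_continuousWithinAt self_mem_Ici
      fun u hu => ?_
    obtain ⟨ε, hε, hu⟩ := mem_uniformity_edist.1 hu
    obtain ⟨y, hy⟩ := h ε hε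
    refine ⟨univ, univ_mem, y, y.right_cont t, fun s _ => hu ?_⟩
    rw [edist_comm]
    exact (edist_le_unifDist y f s).trans_lt hy
  · have : (𝓝[<] t).NeBot := nhdsLT_neBot_of_exists_lt ⟨0, ht⟩
    refine CompleteSpace.complete (EMetric.cauchy_iff.2 ⟨(inferInstance : (map f (𝓝[<] t)).NeBot).ne,
      fun ε hε => ?_⟩)
    obtain ⟨ε', hε', hlt⟩ := exists_between hε
    have hε3 : 0 < ε' / 3 := ENNReal.div_pos hε'.ne' (by norm_num)
    obtain ⟨y, hy⟩ := h (ε' / 3) hε3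
    obtain ⟨a, hat, ha⟩ := y.exists_osc_Ico_le_left ht hε3
    refine ⟨f '' Ioo a t, image_mem_map (Ioo_mem_nhdsLT hat), ?_⟩
    -- The order `r ≤ s` puts both points in `Ico r t`, where the oscillation of `y` is controlled.
    have key : ∀ r s : I, a < r → r ≤ s → s < t → edist (f r) (f s) < ε := fun r s hr hrs hs => by
      have h1 := (edist_le_unifDist y f r).trans_lt hy
      have h2 := (edist_le_unifDist y f s).trans_lt hy
      have h3 : edist (y r) (y s) ≤ ε' / 3 :=
        (edist_le_osc (T := Ico r t) ⟨le_rfl, hrs.trans_lt hs⟩ ⟨hrs, hs⟩).trans (ha r hr)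
      calc edist (f r) (f s) ≤ edist (f r) (y r) + edist (y r) (y s) + edist (y s) (f s) :=
            edist_triangle4 _ _ _ _
        _ ≤ ε' / 3 + ε' / 3 + ε' / 3 := by
            rw [edist_comm (f r)]
            exact add_le_add (add_le_add h1.le h3) h2.le
        _ = ε' := ENNReal.add_thirds ε'
        _ < ε := hlt
    rintro _ ⟨r, hr, rfl⟩ _ ⟨s, hs, rfl⟩
    rcases le_total r s with hrs | hrs
    · exact key r s hr.1 hrs hs.2
    · rw [edist_comm]
      exact key s r hs.1 hrs hr.2

/-- The composition `ν (n + m - 1) ∘ ⋯ ∘ ν n`. -/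
def iterComp (ν : ℕ → TimeChange) (n : ℕ) : ℕ → TimeChange
  | 0 => OrderIso.refl I
  | m + 1 => (iterComp ν n m).trans (ν (n + m))

theorem iterComp_succ_apply (ν : ℕ → TimeChange) (n m : ℕ) (t : I) :
    iterComp ν n (m + 1) t = ν (n + m) (iterComp ν n m t) := rfl

/-- Peeling off the innermost factor instead of the outermost one yields, as `m → ∞`, the relation
`μ (n + 1) ∘ ν n = μ n`. -/
theorem iterComp_succ_apply' (ν : ℕ → TimeChange) (n m : ℕ) (t : I) :
    iterComp ν n (m + 1) t = iterComp ν (n + 1) m (ν n t) := by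
  induction m with
  | zero => rfl
  | succ m ih =>
    rw [iterComp_succ_apply, ih, iterComp_succ_apply]
    congr 2
    omega

/-- The bound is the exact geometric sum of the log norms of the factors; keeping the subtracted
term makes the induction close. -/
theorem logNorm_iterComp_le {ν : ℕ → TimeChange}
    (h : ∀ n, logNorm (ν n) ≤ ENNReal.ofReal ((1 / 2) ^ n)) (n m : ℕ) :
    logNorm (iterComp ν n m) ≤ ENNReal.ofReal (2 * (1 / 2) ^ n - 2 * (1 / 2) ^ (n + m)) := by
  induction m with
  | zero => simp [iterComp, logNorm_refl]
  | succ m ih =>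
    refine (logNorm_trans_le _ _).trans ((add_le_add ih (h _)).trans ?_)
    rw [← ENNReal.ofReal_add _ (by positivity)]
    · refine ENNReal.ofReal_le_ofReal (le_of_eq ?_)
      rw [← add_assoc, pow_succ _ (n + m)]
      ring
    · have : ((1 : ℝ) / 2) ^ (n + m) ≤ (1 / 2) ^ n :=
        pow_le_pow_of_le_one (by norm_num) (by norm_num) (Nat.le_add_right _ _)
      linarith

theorem logNorm_iterComp_le' {ν : ℕ → TimeChange}
    (h : ∀ n, logNorm (ν n) ≤ ENNReal.ofReal ((1 / 2) ^ n)) (n m : ℕ) :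
    logNorm (iterComp ν n m) ≤ ENNReal.ofReal (2 * (1 / 2) ^ n) := by
  refine (logNorm_iterComp_le h n m).trans (ENNReal.ofReal_le_ofReal ?_)
  have : (0 : ℝ) ≤ (1 / 2) ^ (n + m) := by positivity
  linarith

/-- The infinite compositions `⋯ ∘ ν (n + 1) ∘ ν n` of time changes with summable log norms. -/
theorem exists_infinite_comp {ν : ℕ → TimeChange}
    (h : ∀ n, logNorm (ν n) ≤ ENNReal.ofReal ((1 / 2) ^ n)) :
    ∃ μ : ℕ → TimeChange, (∀ n, logNorm (μ n) ≤ ENNReal.ofReal (2 * (1 / 2) ^ n)) ∧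
      ∀ n t, μ (n + 1) (ν n t) = μ n t := by
  have hlim : ∀ n t, ∃ l : I, Tendsto (fun m => iterComp ν n m t) atTop (𝓝 l) := fun n t => by
    -- With `c = (1/2)^(n+m) ≤ 1`, the next factor moves points by at most `exp c - 1 ≤ 2 * c`.
    refine cauchySeq_tendsto_of_complete (cauchySeq_of_le_geometric (1 / 2) 2 (by norm_num)
      fun m => ?_)
    rw [iterComp_succ_apply, dist_comm, Subtype.dist_eq, Real.dist_eq]
    refine (abs_sub_le_of_logNorm_le (by positivity) (h (n + m)) _).trans ?_
    have h1 : ((1 : ℝ) / 2) ^ (n + m) ≤ (1 / 2) ^ m :=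
      pow_le_pow_of_le_one (by norm_num) (by norm_num) (Nat.le_add_left _ _)
    have h2 : ((1 : ℝ) / 2) ^ (n + m) ≤ 1 := pow_le_one₀ (by norm_num) (by norm_num)
    have h0 : (0 : ℝ) ≤ (1 / 2) ^ (n + m) := by positivity
    have h3 := Real.abs_exp_sub_one_le (x := (1 / 2) ^ (n + m)) (by rwa [abs_of_nonneg h0])
    rw [abs_of_nonneg h0] at h3
    linarith [le_abs_self (Real.exp ((1 / 2) ^ (n + m)) - 1)]
  choose g hg using hlim
  have hμ : ∀ n, ∃ μ : TimeChange, ⇑μ = g n ∧ logNorm μ ≤ ENNReal.ofReal (2 * (1 / 2) ^ n) := by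
    intro n
    refine exists_timeChange_of_slope_bounds (g n) _ ?_ ?_ fun s s' hs => ?_
    · refine tendsto_nhds_unique (hg n 0) ?_
      simp [timeChange_zero]
    · refine tendsto_nhds_unique (hg n 1) ?_
      simp [timeChange_one]
    -- Slope bounds are closed under pointwise limits; the lower one keeps the limit strictly
    -- increasing.
    · have hd : Tendsto (fun m => (iterComp ν n m s' : ℝ) - iterComp ν n m s) atTop
          (𝓝 ((g n s' : ℝ) - g n s)) :=
        ((continuous_subtype_val.tendsto _).comp (hg n s')).sub
          ((continuous_subtype_val.tendsto _).comp (hg n s))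
      have hb := fun m => slope_bounds_of_logNorm_le (by positivity) (logNorm_iterComp_le' h n m) hs
      exact ⟨ge_of_tendsto' hd fun m => (hb m).1, le_of_tendsto' hd fun m => (hb m).2⟩
  choose μ hμg hμ using hμ
  refine ⟨μ, hμ, fun n t => ?_⟩
  rw [hμg, hμg]
  refine tendsto_nhds_unique (hg (n + 1) (ν n t)) ?_
  simp_rw [← iterComp_succ_apply']
  exact (tendsto_add_atTop_iff_nat 1).2 (hg n t)

/-- Càdlàg functions with the Skorohod distance in which time changes are measured by `logNorm`. -/
def LogCadlag (S : Type*) [TopologicalSpace S] := Cadlag S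

noncomputable instance : PseudoEMetricSpace (LogCadlag S) where
  edist x y := timeChangeDist logNorm x.toFun y.toFun
  edist_self x := timeChangeDist_self logNorm_refl x.toFun
  edist_comm x y := le_antisymm (timeChangeDist_comm_le logNorm_symm_le x.toFun y.toFun)
    (timeChangeDist_comm_le logNorm_symm_le y.toFun x.toFun)
  edist_triangle x y z := timeChangeDist_triangle logNorm_trans_le x.toFun y.toFun z.toFun

theorem ofReal_half_pow (n : ℕ) : ENNReal.ofReal ((1 / 2) ^ n) = 1 / 2 ^ n := by
  rw [ENNReal.ofReal_pow (by norm_num), ENNReal.ofReal_div_of_pos (by norm_num)]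
  simp [ENNReal.inv_pow]

/-- If `ν n` aligns `u n` with `u (n + 1)` and `μ n` is the infinite composition starting at `ν n`,
then `(μ (n + 1)).symm = ν n ∘ (μ n).symm`. Hence the functions `u n ∘ (μ n).symm` are uniformly
Cauchy, and `μ n` aligns `u n` with their limit. -/
instance [CompleteSpace S] : CompleteSpace (LogCadlag S) := by
  have hpow : ∀ n : ℕ, ENNReal.ofReal (2 * (1 / 2) ^ n) = 2 * 1 / 2 ^ n := fun n => by
    rw [ENNReal.ofReal_mul (by norm_num), ofReal_half_pow, mul_div_assoc]
    simp
  refine EMetric.complete_of_convergent_controlled_sequences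
    (fun n => ENNReal.ofReal ((1 / 2) ^ n)) (fun n => ENNReal.ofReal_pos.2 (by positivity))
    fun u hu => ?_
  have hν : ∀ n, ∃ ν : TimeChange, logNorm ν < ENNReal.ofReal ((1 / 2) ^ n) ∧
      unifDist (u n).toFun ((u (n + 1)).toFun ∘ ν) < ENNReal.ofReal ((1 / 2) ^ n) := fun n =>
    timeChangeDist_lt_iff.1 (hu n n (n + 1) le_rfl n.le_succ)
  choose ν hν hu' using hν
  obtain ⟨μ, hμ, hμν⟩ := exists_infinite_comp fun n => (hν n).le
  let y : ℕ → Cadlag S := fun n => Cadlag.comp (u n) (μ n).symm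
  have hy : ∀ t n, edist (y n t) (y (n + 1) t) ≤ 1 / 2 ^ n := fun t n => by
    have h1 : (μ (n + 1)).symm t = ν n ((μ n).symm t) := by
      rw [OrderIso.symm_apply_eq, hμν, OrderIso.apply_symm_apply]
    have h2 := (edist_le_unifDist _ _ ((μ n).symm t)).trans (hu' n).le
    rw [ofReal_half_pow] at h2
    change edist ((u n).toFun ((μ n).symm t)) ((u (n + 1)).toFun ((μ (n + 1)).symm t)) ≤ _
    rw [h1]
    exact h2
  have hz : ∀ t, ∃ l, Tendsto (fun n => y n t) atTop (𝓝 l) := fun t =>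
    cauchySeq_tendsto_of_complete (cauchySeq_of_edist_le_geometric_two 1 ENNReal.one_ne_top (hy t))
  choose f hf using hz
  have hyf : ∀ n, unifDist (y n) f ≤ 2 * 1 / 2 ^ n := fun n => iSup_le fun t =>
    edist_le_of_edist_le_geometric_two_of_tendsto 1 (hy t) (hf t) n
  have hto : Tendsto (fun n : ℕ => (2 * 1 / 2 ^ n : ℝ≥0∞)) atTop (𝓝 0) := by
    have h := ENNReal.tendsto_ofReal ((tendsto_pow_atTop_nhds_zero_of_lt_one
      (r := (1 / 2 : ℝ)) (by norm_num) (by norm_num)).const_mul 2)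
    simp only [mul_zero, ENNReal.ofReal_zero, hpow] at h
    exact h
  obtain ⟨z, rfl⟩ := exists_cadlag_of_unifDist_lt f fun ε hε => by
    obtain ⟨n, hn⟩ := (hto.eventually (eventually_lt_nhds hε)).exists
    exact ⟨y n, (hyf n).trans_lt hn⟩
  refine ⟨z, tendsto_iff_edist_tendsto_0.2 (tendsto_of_tendsto_of_tendsto_of_le_of_le
    tendsto_const_nhds hto (fun _ => zero_le) fun n => ?_)⟩
  refine iInf_le_of_le (μ n) (max_le ((hμ n).trans (hpow n).le) (iSup_le fun t => ?_))
  · have := (edist_le_unifDist (y n) z (μ n t)).trans (hyf n)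
    change edist ((u n).toFun ((μ n).symm (μ n t))) _ ≤ _ at this
    rwa [OrderIso.symm_apply_apply] at this

end Completeness

/-! ### Total boundedness by step functions on a grid -/

section TotalBoundedness

variable {S : Type*} [PseudoEMetricSpace S]

theorem tendsto_mul_nhdsGE (N : ℕ) (t : I) :
    Tendsto (fun s : I => (N : ℝ) * s) (𝓝[≥] t) (𝓝[≥] ((N : ℝ) * t)) :=
  tendsto_nhdsWithin_of_tendsto_nhds_of_eventually_within _
    ((by fun_prop : Continuous fun s : I => (N : ℝ) * s).continuousAt.mono_left nhdsWithin_le_nhds)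
    (eventually_nhdsWithin_of_forall fun s hs =>
      mem_Ici.2 (mul_le_mul_of_nonneg_left (Subtype.coe_le_coe.2 (mem_Ici.1 hs)) N.cast_nonneg))

theorem tendsto_mul_nhdsLT {N : ℕ} (hN : 0 < N) (t : I) :
    Tendsto (fun s : I => (N : ℝ) * s) (𝓝[<] t) (𝓝[<] ((N : ℝ) * t)) :=
  tendsto_nhdsWithin_of_tendsto_nhds_of_eventually_within _
    ((by fun_prop : Continuous fun s : I => (N : ℝ) * s).continuousAt.mono_left nhdsWithin_le_nhds)
    (eventually_nhdsWithin_of_forall fun s hs =>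
      mem_Iio.2 (mul_lt_mul_of_pos_left (Subtype.coe_lt_coe.2 (mem_Iio.1 hs)) (Nat.cast_pos.2 hN)))

/-- The step function with value `g k` on `[k / N, (k + 1) / N)`. -/
noncomputable def gridStep (N : ℕ) (hN : 0 < N) (g : Fin (N + 1) → S) : Cadlag S where
  -- The index lies in `[0, N]`, so `Fin.ofNat` never wraps around; the index `N` occurs only at `u
  -- = 1`.
  toFun u := g (Fin.ofNat (N + 1) ⌊(N : ℝ) * u⌋.toNat)
  right_cont t := by
    have h := tendsto_pure.1 ((tendsto_floor_right_pure_floor _).comp (tendsto_mul_nhdsGE N t))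
    refine tendsto_const_nhds.congr' (h.mono fun s hs => ?_)
    simp only [Function.comp_apply] at hs
    simp only [hs]
  left_lim t _ := by
    have h := tendsto_pure.1
      ((tendsto_floor_left_pure_ceil_sub_one _).comp (tendsto_mul_nhdsLT hN t))
    refine ⟨g (Fin.ofNat (N + 1) (⌈(N : ℝ) * t⌉ - 1).toNat),
      tendsto_const_nhds.congr' (h.mono fun s hs => ?_)⟩
    simp only [Function.comp_apply] at hs
    simp only [hs]

theorem IsSparse.lt_sub {δ : ℝ} {v : ℕ} {t : Fin (v + 1) → I} (ht : IsSparse δ t)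
    {i j : Fin (v + 1)} (hij : i < j) : δ < (t j : ℝ) - t i := by
  induction i using Fin.lastCases with
  | last => exact absurd (Fin.le_last j) (not_le.2 hij)
  | cast i =>
    have h : t i.succ ≤ t j := ht.strictMono.monotone (Fin.castSucc_lt_iff_succ_le.1 hij)
    have h' : (t i.succ : ℝ) ≤ t j := h
    linarith [ht.gap i]

/-- A sparse set can be moved onto the grid `{k / N}` by a time change of small log norm. -/
theorem IsSparse.exists_timeChange {δ c : ℝ} {N v : ℕ} (hN : 0 < N) (hc : 0 < c)
    (hNδ : 1 / (N : ℝ) ≤ (1 - Real.exp (-c)) * δ) {t : Fin (v + 1) → I} (ht : IsSparse δ t) :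
    ∃ μ : TimeChange, logNorm μ ≤ ENNReal.ofReal c ∧
      ∀ i, (μ (t i) : ℝ) = ⌊(N : ℝ) * t i⌋ / N := by
  have hN' : (0 : ℝ) < N := Nat.cast_pos.2 hN
  set κ : ℝ := 1 - Real.exp (-c) with hκ
  have hκ0 : 0 < κ := by
    have : Real.exp (-c) < 1 := Real.exp_lt_one_iff.2 (by linarith)
    linarith
  -- The displacement to the grid lies in `[-1/N, 0]`. Partition points are more than `δ` apart and
  -- `1/N ≤ κ * δ`, so it is `κ`-Lipschitz on them.
  let h : I → ℝ := fun s => ⌊(N : ℝ) * s⌋ / N - s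
  have hh : ∀ s, -(1 / (N : ℝ)) ≤ h s ∧ h s ≤ 0 := fun s => by
    have h1 := Int.floor_le ((N : ℝ) * s)
    have h2 := Int.lt_floor_add_one ((N : ℝ) * s)
    simp only [h]
    constructor
    · rw [le_sub_iff_add_le, le_div_iff₀ hN']
      have : (-(1 / (N : ℝ)) + s) * N = N * s - 1 := by field_simp; ring
      linarith
    · rw [sub_nonpos, div_le_iff₀ hN']
      linarith
  have hlip : LipschitzOnWith κ.toNNReal h (range t) := by
    refine LipschitzOnWith.of_dist_le_mul ?_
    rintro _ ⟨i, rfl⟩ _ ⟨j, rfl⟩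
    rw [Real.coe_toNNReal _ hκ0.le, Subtype.dist_eq, Real.dist_eq, Real.dist_eq]
    have key : ∀ i j, i < j → |h (t i) - h (t j)| ≤ κ * |(t i : ℝ) - t j| := fun i j hij => by
      have h1 : |h (t i) - h (t j)| ≤ 1 / N :=
        abs_le.2 ⟨by linarith [hh (t i), hh (t j)], by linarith [hh (t i), hh (t j)]⟩
      have h2 : δ ≤ |(t i : ℝ) - t j| := by
        rw [abs_sub_comm]
        exact (ht.lt_sub hij).le.trans (le_abs_self _)
      exact h1.trans (hNδ.trans (mul_le_mul_of_nonneg_left h2 hκ0.le))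
    rcases lt_trichotomy i j with hij | rfl | hij
    · exact key i j hij
    · simp
    · rw [abs_sub_comm, abs_sub_comm (t i : ℝ)]
      exact key j i hij
  -- For a `κ`-Lipschitz extension `k`, the map `s + k s` has slopes between `1 - κ = exp (-c)` and
  -- `1 + κ ≤ exp c`. It fixes 0 and 1, which are grid points.
  obtain ⟨k, hk, hkh⟩ := hlip.extend_real
  have hslope : ∀ s s' : I, s ≤ s' →
      Real.exp (-c) * ((s' : ℝ) - s) ≤ (s' + k s') - (s + k s) ∧
        (s' + k s') - (s + k s) ≤ Real.exp c * ((s' : ℝ) - s) := fun s s' hs => by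
    have h0 : (0 : ℝ) ≤ (s' : ℝ) - s := sub_nonneg.2 hs
    have h1 := hk.dist_le_mul s' s
    rw [Real.coe_toNNReal _ hκ0.le, Subtype.dist_eq, Real.dist_eq, Real.dist_eq,
      abs_of_nonneg h0] at h1
    obtain ⟨h2, h3⟩ := abs_le.1 h1
    have h4 : 1 + κ ≤ Real.exp c := by
      have := Real.add_one_le_exp c
      have := Real.add_one_le_exp (-c)
      linarith
    constructor
    · have : Real.exp (-c) = 1 - κ := by rw [hκ]; ring
      rw [this]
      linarith
    · have := mul_le_mul_of_nonneg_right h4 h0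
      linarith
  have hk0 : k 0 = 0 := by
    rw [← ht.zero, ← hkh (mem_range_self 0), ht.zero]
    simp [h]
  have hk1 : k 1 = 0 := by
    rw [← ht.last, ← hkh (mem_range_self (Fin.last v)), ht.last]
    simp [h, hN'.ne']
  have hmem : ∀ s : I, (s : ℝ) + k s ∈ I := fun s => by
    have h1 := (hslope 0 s unitInterval.nonneg').1
    have h2 := (hslope s 1 unitInterval.le_one').1
    have h3 : 0 ≤ Real.exp (-c) * (s : ℝ) := mul_nonneg (Real.exp_pos _).le s.2.1
    have h4 : 0 ≤ Real.exp (-c) * (1 - (s : ℝ)) :=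
      mul_nonneg (Real.exp_pos _).le (sub_nonneg.2 s.2.2)
    simp only [hk0, hk1, Set.Icc.coe_zero, Set.Icc.coe_one] at h1 h2
    exact ⟨by linarith, by linarith⟩
  obtain ⟨μ, hμ, hlog⟩ := exists_timeChange_of_slope_bounds (fun s => ⟨s + k s, hmem s⟩) c
    (Subtype.ext (by simp [hk0])) (Subtype.ext (by simp [hk1])) hslope
  refine ⟨μ, hlog, fun i => ?_⟩
  rw [hμ]
  change (t i : ℝ) + k (t i) = _
  rw [← hkh (mem_range_self i)]
  simp [h]

/-- Approximation of a function with small modulus by a grid step function. -/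
theorem exists_gridStep_timeChangeDist_le {x : I → S} {δ c : ℝ} {ε ε' : ℝ≥0∞} {N : ℕ}
    (hN : 0 < N) (hc : 0 < c) (hNδ : 1 / (N : ℝ) ≤ (1 - Real.exp (-c)) * δ)
    (hx : modulus x δ < ε) {F : Set S} (hF : ∀ t, ∃ f ∈ F, edist (x t) f ≤ ε') :
    ∃ g : Fin (N + 1) → F, timeChangeDist logNorm x (gridStep N hN fun k => (g k : S)) ≤
      max (ENNReal.ofReal c) (ε + ε') := by
  have hN' : (0 : ℝ) < N := Nat.cast_pos.2 hN
  obtain ⟨v, t, ht, hosc⟩ := modulus_lt_iff.1 hx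
  obtain ⟨μ, hμ, hμt⟩ := ht.exists_timeChange hN hc hNδ
  let p : Fin (N + 1) → I := fun k => ⟨(k : ℝ) / N, by positivity, by
    rw [div_le_one hN']; exact_mod_cast Nat.lt_succ_iff.1 k.2⟩
  choose f hfF hf using hF
  -- On the `k`-th cell the step takes a value near `x` at the preimage of the left grid point.
  -- Partition points are mapped to grid points, so this preimage shares a partition interval with
  -- every `s < 1` that `μ` sends into the cell.
  refine ⟨fun k => ⟨f (μ.symm (p k)), hfF _⟩, iInf_le_of_le μ (max_le_max hμ (iSup_le fun s => ?_))⟩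
  set k : Fin (N + 1) := Fin.ofNat (N + 1) ⌊(N : ℝ) * μ s⌋.toNat with hk
  have hkf : ((k : ℕ) : ℤ) = ⌊(N : ℝ) * μ s⌋ := by
    have h0 : 0 ≤ ⌊(N : ℝ) * μ s⌋ := Int.floor_nonneg.2 (mul_nonneg hN'.le (μ s).2.1)
    have h1 : ⌊(N : ℝ) * μ s⌋ ≤ N := by
      have : (N : ℝ) * μ s ≤ N := mul_le_of_le_one_right hN'.le (μ s).2.2
      exact_mod_cast (Int.floor_le _).trans this
    rw [hk, Fin.val_ofNat, Nat.mod_eq_of_lt (by omega)]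
    omega
  have hkr : ((k : ℕ) : ℝ) = ⌊(N : ℝ) * μ s⌋ := by rw [← hkf]; simp
  change edist (x s) (f (μ.symm (p k))) ≤ ε + ε'
  refine (edist_triangle _ (x (μ.symm (p k))) _).trans (add_le_add ?_ (hf _))
  rcases (unitInterval.le_one' (t := s)).eq_or_lt with rfl | hs
  · have : p k = 1 := by
      refine Subtype.ext ?_
      simp only [p, hkr, timeChange_one]
      simp [hN'.ne']
    rw [this, timeChange_one, edist_self]
    exact zero_le
  · obtain ⟨i, hi⟩ := exists_mem_Ico_of_partition ht.zero ht.last hs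
    have hle : ∀ i : Fin v, osc x (Ico (t i.castSucc) (t i.succ)) ≤ ε :=
      iSup_le_iff.1 hosc.le
    refine (edist_le_osc hi ⟨?_, ?_⟩).trans (hle i)
    · rw [OrderIso.le_symm_apply, ← Subtype.coe_le_coe, hμt]
      have h1 : (μ (t i.castSucc) : ℝ) ≤ μ s := μ.monotone hi.1
      rw [hμt, div_le_iff₀ hN'] at h1
      refine div_le_div_of_nonneg_right ?_ hN'.le
      rw [hkr, Int.cast_le, Int.le_floor]
      linarith
    · rw [OrderIso.symm_apply_lt]
      refine lt_of_le_of_lt ?_ (μ.strictMono hi.2)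
      rw [← Subtype.coe_le_coe]
      change ((k : ℕ) : ℝ) / N ≤ _
      rw [hkr, div_le_iff₀ hN', mul_comm]
      exact Int.floor_le _

theorem exists_pos_ofReal_lt {ε : ℝ≥0∞} (hε : 0 < ε) : ∃ c > 0, ENNReal.ofReal c < ε := by
  obtain ⟨c, hc, hcε⟩ := ENNReal.lt_iff_exists_nnreal_btwn.1 hε
  exact ⟨c, by exact_mod_cast hc, by simpa using hcε⟩

/-- A set of càdlàg functions with totally bounded set of values and uniformly small moduli is
totally bounded. -/
theorem totallyBounded_logCadlag {A : Set (LogCadlag S)}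
    (hB : TotallyBounded {y : S | ∃ x ∈ A, ∃ t, x.toFun t = y})
    (hA : Tendsto (fun δ : ℝ => ⨆ x ∈ A, modulus x.toFun δ) (𝓝[>] 0) (𝓝 0)) :
    TotallyBounded A := by
  refine EMetric.totallyBounded_iff.2 fun ε hε => ?_
  obtain ⟨c, hc, hcε⟩ := exists_pos_ofReal_lt hε
  have hc2 : 0 < ENNReal.ofReal (c / 2) := ENNReal.ofReal_pos.2 (half_pos hc)
  obtain ⟨δ, hδ, hδ0⟩ :=
    ((hA.eventually (eventually_lt_nhds hc2)).and self_mem_nhdsWithin).exists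
  replace hδ0 : 0 < δ := hδ0
  obtain ⟨F, hFfin, hF⟩ := EMetric.totallyBounded_iff.1 hB _ hc2
  have hκ : 0 < (1 - Real.exp (-c)) * δ :=
    mul_pos (sub_pos.2 (Real.exp_lt_one_iff.2 (by linarith))) hδ0
  obtain ⟨n, hn⟩ := exists_nat_one_div_lt hκ
  have : Finite F := hFfin
  -- Grid size and `F` do not depend on `x`, so finitely many step functions serve all of `A`.
  refine ⟨range fun g : Fin (n + 1 + 1) → F =>
    (gridStep (n + 1) n.succ_pos fun k => (g k : S) : Cadlag S), finite_range _, fun x hx => ?_⟩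
  obtain ⟨g, hg⟩ := exists_gridStep_timeChangeDist_le (x := x.toFun) (F := F) n.succ_pos hc
    (by push_cast; exact hn.le)
    ((le_iSup₂ (f := fun (x : LogCadlag S) (_ : x ∈ A) => modulus x.toFun δ) x hx).trans_lt hδ)
    fun t => by
      obtain ⟨f, hf, hxf⟩ := mem_iUnion₂.1 (hF ⟨x, hx, t, rfl⟩)
      exact ⟨f, hf, hxf.le⟩
  refine mem_iUnion₂.2 ⟨_, mem_range_self g, hg.trans_lt ?_⟩
  rwa [← ENNReal.ofReal_add (half_pos hc).le (half_pos hc).le, add_halves, max_self]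

end TotalBoundedness

/-! ### Consequences of compactness, and transfer between the two distances -/

section Compactness

theorem D.edist_lt_iff {x y : D} {ε : ℝ≥0∞} :
    edist x y < ε ↔ ∃ μ : TimeChange, logNorm μ < ε ∧ unifDist x (y ∘ μ) < ε :=
  timeChangeDist_lt_iff

theorem DD.edist_lt_iff {x y : DD} {ε : ℝ≥0∞} :
    edist x y < ε ↔ ∃ μ : TimeChange, dispNorm μ < ε ∧ unifDist x (y ∘ μ) < ε :=
  timeChangeDist_lt_iff

/-- The set of all values `x(t)` of the elements `x` of `A`. -/
def valueSet (A : Set DD) : Set D := {y | ∃ x ∈ A, ∃ t, x t = y}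

/-- If `x` is close to `z` through `μ`, then `x t` is close to `z (μ t)`. The values of `A` are thus
near the ranges of finitely many `z`, each totally bounded. -/
theorem totallyBounded_valueSet {A : Set DD} (hA : TotallyBounded A) :
    TotallyBounded (valueSet A) := by
  refine EMetric.totallyBounded_iff.2 fun ε hε => ?_
  have hε2 := ENNReal.half_pos hε.ne'
  obtain ⟨F, hF, hAF⟩ := EMetric.totallyBounded_iff.1 hA _ hε2
  obtain ⟨G, hG, hFG⟩ := EMetric.totallyBounded_iff.1 ((totallyBounded_biUnion hF
    (s := fun z : DD => range z)).2 fun z _ => z.totallyBounded_range) _ hε2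
  refine ⟨G, hG, ?_⟩
  rintro _ ⟨x, hx, t, rfl⟩
  obtain ⟨z, hz, hxz⟩ := mem_iUnion₂.1 (hAF hx)
  obtain ⟨μ, -, hμ⟩ := DD.edist_lt_iff.1 hxz
  obtain ⟨w, hw, hzw⟩ := mem_iUnion₂.1 (hFG (mem_iUnion₂.2 ⟨z, hz, mem_range_self (μ t)⟩))
  refine mem_iUnion₂.2 ⟨w, hw, ?_⟩
  calc edist (x t) w ≤ edist (x t) (z (μ t)) + edist (z (μ t)) w := edist_triangle _ _ _
    _ < ε / 2 + ε / 2 :=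
      ENNReal.add_lt_add ((edist_le_unifDist x (z ∘ μ) t).trans_lt hμ) hzw
    _ = ε := ENNReal.add_halves ε

theorem supNorm_lt_top (x : D) : supNorm x < ∞ := by
  obtain ⟨C, hC⟩ := isBounded_iff_forall_norm_le.1 x.totallyBounded_range.isBounded
  exact (iSup_le fun s => ENNReal.ofReal_le_ofReal (hC _ (mem_range_self s))).trans_lt
    ENNReal.ofReal_lt_top

theorem supNorm_le_add {x y : D} {ε : ℝ≥0∞} (h : edist x y < ε) : supNorm x ≤ supNorm y + ε := by
  obtain ⟨μ, -, hμ⟩ := D.edist_lt_iff.1 h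
  refine iSup_le fun s => ?_
  have h1 := ((edist_le_unifDist x (y ∘ μ) s).trans_lt hμ).le
  have h2 : ENNReal.ofReal |y (μ s)| ≤ supNorm y :=
    le_iSup (fun s : I => ENNReal.ofReal |y s|) (μ s)
  refine le_trans ?_ (add_le_add h2 h1)
  rw [edist_dist, Real.dist_eq, ← ENNReal.ofReal_add (abs_nonneg _) (abs_nonneg _)]
  refine ENNReal.ofReal_le_ofReal ?_
  have := abs_add_le (y (μ s)) (x s - y (μ s))
  rwa [add_sub_cancel] at this

theorem iSup_supNorm_lt_top {B : Set D} (hB : TotallyBounded B) : ⨆ y ∈ B, supNorm y < ∞ := by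
  obtain ⟨F, hF, hBF⟩ := EMetric.totallyBounded_iff.1 hB 1 one_pos
  have hsum : ∑ z ∈ hF.toFinset, supNorm z + 1 < ∞ :=
    ENNReal.add_lt_top.2 ⟨ENNReal.sum_lt_top.2 fun z _ => supNorm_lt_top z, ENNReal.one_lt_top⟩
  refine (iSup₂_le fun y hy => ?_).trans_lt hsum
  obtain ⟨z, hz, hyz⟩ := mem_iUnion₂.1 (hBF hy)
  exact (supNorm_le_add hyz).trans (add_le_add_left
    (Finset.single_le_sum (f := supNorm) (fun _ _ => zero_le) (hF.mem_toFinset.2 hz)) 1)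

theorem eventually_modulus_lt {S : Type*} [PseudoEMetricSpace S] (x : Cadlag S) {ε : ℝ≥0∞}
    (hε : 0 < ε) : ∀ᶠ δ in 𝓝[>] (0 : ℝ), modulus x δ < ε := by
  obtain ⟨ε', hε', hlt⟩ := exists_between hε
  obtain ⟨δ, hδ, hx⟩ := x.exists_modulus_le hε'
  filter_upwards [Ioo_mem_nhdsGT hδ] with δ' hδ'
  exact ((modulus_mono x hδ'.2.le).trans hx).trans_lt hlt

theorem exists_ofReal_add_two_mul_le {ε : ℝ≥0∞} (hε : 0 < ε) :
    ∃ c : ℝ, 0 < c ∧ c < 1 ∧ ENNReal.ofReal c + 2 * ENNReal.ofReal c ≤ ε := by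
  obtain ⟨c, hc, hcε⟩ := exists_pos_ofReal_lt
    (lt_min one_pos (ENNReal.div_pos hε.ne' (by norm_num : (3 : ℝ≥0∞) ≠ ∞)))
  obtain ⟨h1, h2⟩ := lt_min_iff.1 hcε
  refine ⟨c, hc, by simpa using h1, ?_⟩
  calc ENNReal.ofReal c + 2 * ENNReal.ofReal c ≤ ε / 3 + 2 * (ε / 3) := by gcongr
    _ = ε / 3 + ε / 3 + ε / 3 := by ring
    _ = ε := ENNReal.add_thirds ε

/-- Moduli are uniformly small on totally bounded subsets of `𝔻`. -/
theorem exists_modulus_le_of_totallyBounded {B : Set D} (hB : TotallyBounded B) {ε : ℝ≥0∞}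
    (hε : 0 < ε) : ∃ δ > 0, ∀ y ∈ B, modulus y δ ≤ ε := by
  obtain ⟨c, hc, hc1, hcε⟩ := exists_ofReal_add_two_mul_le hε
  have hc' := ENNReal.ofReal_pos.2 hc
  obtain ⟨F, hF, hBF⟩ := EMetric.totallyBounded_iff.1 hB _ hc'
  obtain ⟨δ, hδ, hδ0⟩ := (((eventually_all_finite hF).2 fun z _ =>
    eventually_modulus_lt z hc').and self_mem_nhdsWithin).exists
  -- Slopes of at least `exp (-c)` shrink every gap by at most this factor.
  refine ⟨Real.exp (-c) * δ, mul_pos (Real.exp_pos _) hδ0, fun y hy => ?_⟩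
  obtain ⟨z, hz, hyz⟩ := mem_iUnion₂.1 (hBF hy)
  obtain ⟨μ, hμ, hzy⟩ := D.edist_lt_iff.1 ((edist_comm _ _).trans_lt hyz)
  refine (modulus_le_of_timeChange μ (fun s s' hs hδs => ?_) (hδ z hz) hzy.le).trans hcε
  exact (mul_lt_mul_of_pos_left hδs (Real.exp_pos _)).trans_le
    (slope_bounds_of_logNorm_le hc.le hμ.le hs.le).1

/-- Moduli are uniformly small on compact subsets of `𝔻([0,1];𝔻)`. -/
theorem exists_modulus_le_of_isCompact {K : Set DD} (hK : IsCompact K) {ε : ℝ≥0∞} (hε : 0 < ε) :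
    ∃ δ > 0, ∀ x ∈ K, modulus x δ ≤ ε := by
  refine hK.induction_on (p := fun K => ∃ δ > 0, ∀ x ∈ K, modulus x δ ≤ ε) ⟨1, one_pos, by simp⟩
    ?_ ?_ ?_
  · rintro s t hst ⟨δ, hδ, h⟩
    exact ⟨δ, hδ, fun x hx => h x (hst hx)⟩
  · rintro s t ⟨δ, hδ, h⟩ ⟨δ', hδ', h'⟩
    refine ⟨min δ δ', lt_min hδ hδ', fun x hx => hx.elim (fun hx => ?_) fun hx => ?_⟩
    · exact (modulus_mono x (min_le_left _ _)).trans (h x hx)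
    · exact (modulus_mono x (min_le_right _ _)).trans (h' x hx)
  · intro x _
    obtain ⟨c, hc, -, hcε⟩ := exists_ofReal_add_two_mul_le hε
    obtain ⟨δ, hδ, hδ0⟩ := ((eventually_modulus_lt x (ENNReal.ofReal_pos.2 hc)).and
      self_mem_nhdsWithin).exists
    replace hδ0 : 0 < δ := hδ0
    -- Each end of a gap moves by at most `δ / 4`, so gaps above `δ` stay above `δ / 2`. The radius
    -- depends on the `δ` of `x`, so a finite net of prescribed radius would not do; compactness is
    -- used.
    have hr : 0 < min c (δ / 4) := lt_min hc (by linarith)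
    refine ⟨_, mem_nhdsWithin_of_mem_nhds (Metric.eball_mem_nhds x (ENNReal.ofReal_pos.2 hr)),
      δ / 2, half_pos hδ0, fun y hy => ?_⟩
    obtain ⟨μ, hμ, hxy⟩ := DD.edist_lt_iff.1 ((edist_comm _ _).trans_lt hy)
    refine (modulus_le_of_timeChange μ (fun s s' hs hδs => ?_) hδ
      (hxy.le.trans (ENNReal.ofReal_le_ofReal (min_le_left _ _)))).trans hcε
    have h1 := (abs_le.1 (abs_sub_le_of_dispNorm_le hr.le hμ.le s)).2
    have h2 := (abs_le.1 (abs_sub_le_of_dispNorm_le hr.le hμ.le s')).1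
    have h3 := min_le_right c (δ / 4)
    linarith

theorem tendsto_nhdsGT_zero_of_monotone {f : ℝ → ℝ≥0∞} (hf : Monotone f)
    (h : ∀ ε > 0, ∃ δ > 0, f δ ≤ ε) : Tendsto f (𝓝[>] 0) (𝓝 0) := by
  refine ENNReal.tendsto_nhds_zero.2 fun ε hε => ?_
  obtain ⟨δ, hδ, hle⟩ := h ε hε
  filter_upwards [Ioo_mem_nhdsGT hδ] with δ' hδ'
  exact (hf hδ'.2.le).trans hle

instance : CompleteSpace D := inferInstanceAs (CompleteSpace (LogCadlag ℝ))

theorem totallyBounded_of_supNorm_of_modulus {B : Set D} (hB : ⨆ y ∈ B, supNorm y < ∞)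
    (hm : Tendsto (fun δ : ℝ => ⨆ y ∈ B, modulus y δ) (𝓝[>] 0) (𝓝 0)) : TotallyBounded B := by
  refine totallyBounded_logCadlag (S := ℝ) (A := B) ?_ hm
  refine (isCompact_closedBall (0 : ℝ) (⨆ y ∈ B, supNorm y).toReal).totallyBounded.subset ?_
  rintro _ ⟨y, hy, s, rfl⟩
  rw [mem_closedBall_zero_iff, Real.norm_eq_abs, ← ENNReal.ofReal_le_iff_le_toReal hB.ne]
  exact (le_iSup (fun s : I => ENNReal.ofReal |y.toFun s|) s).trans
    (le_iSup₂ (f := fun (y : D) (_ : y ∈ B) => supNorm y) y hy)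

/-- The identity map from the log-norm Skorohod distance to the distance of `𝔻([0,1];𝔻)`. -/
def ofLogCadlag (x : LogCadlag D) : DD := x

theorem uniformContinuous_ofLogCadlag : UniformContinuous ofLogCadlag := by
  refine EMetric.uniformContinuous_iff.2 fun ε hε => ?_
  obtain ⟨c, hc, hcε⟩ := exists_pos_ofReal_lt hε
  -- The displacement bound `exp (log (1 + c)) - 1` equals `c`.
  have hlog : 0 < Real.log (1 + c) := Real.log_pos (by linarith)
  refine ⟨min (ENNReal.ofReal (Real.log (1 + c))) ε,
    lt_min (ENNReal.ofReal_pos.2 hlog) hε, fun {x y} hxy => ?_⟩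
  obtain ⟨μ, hμ, hu⟩ := timeChangeDist_lt_iff.1 hxy
  refine DD.edist_lt_iff.2 ⟨μ, ?_, hu.trans_le (min_le_right _ _)⟩
  refine (dispNorm_le_of_logNorm_le hlog.le (hμ.le.trans (min_le_left _ _))).trans_lt ?_
  rwa [Real.exp_log (by linarith), add_sub_cancel_left]

/-- Closing up in the complete log-norm distance gives a compact set; its image in `DD` is compact
and contains `A`. -/
theorem isCompact_closure_of_modulus {A : Set DD} (hA : TotallyBounded (valueSet A))
    (hm : Tendsto (fun δ : ℝ => ⨆ x ∈ A, modulus x δ) (𝓝[>] 0) (𝓝 0)) :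
    IsCompact (closure A) := by
  have htb : TotallyBounded (ofLogCadlag ⁻¹' A) := totallyBounded_logCadlag hA hm
  have hc : IsCompact (closure (ofLogCadlag ⁻¹' A)) :=
    isCompact_iff_totallyBounded_isComplete.2 ⟨htb.closure, isClosed_closure.isComplete⟩
  exact (hc.image uniformContinuous_ofLogCadlag.continuous).closure_of_subset
    fun x hx => ⟨x, subset_closure hx, rfl⟩

end Compactness

end Skorohod

/-! ### The compactness criterion -/

theorem mainTheorem2 (A : Set Skorohod.DD) :
    IsCompact (closure A) ↔
      (⨆ x ∈ A, Skorohod.superNorm x) < ∞ ∧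
      Tendsto (fun δ : ℝ => ⨆ x ∈ A, ⨆ t : I, Skorohod.modulus (x t) δ) (𝓝[>] 0) (𝓝 0) ∧
      Tendsto (fun δ : ℝ => ⨆ x ∈ A, Skorohod.modulus x δ) (𝓝[>] 0) (𝓝 0) := by
  constructor
  · intro hK
    have hB := Skorohod.totallyBounded_valueSet (hK.totallyBounded.subset subset_closure)
    refine ⟨(iSup₂_le fun x hx => iSup_le fun t => ?_).trans_lt (Skorohod.iSup_supNorm_lt_top hB),
      Skorohod.tendsto_nhdsGT_zero_of_monotone ?_ fun ε hε => ?_,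
      Skorohod.tendsto_nhdsGT_zero_of_monotone ?_ fun ε hε => ?_⟩
    · exact le_iSup₂ (f := fun (y : Skorohod.D) (_ : y ∈ Skorohod.valueSet A) =>
        Skorohod.supNorm y) (x t) ⟨x, hx, t, rfl⟩
    · exact fun _ _ h => iSup₂_mono fun x _ => iSup_mono fun t => Skorohod.modulus_mono (x t) h
    · obtain ⟨δ, hδ, h⟩ := Skorohod.exists_modulus_le_of_totallyBounded hB hε
      exact ⟨δ, hδ, iSup₂_le fun x hx => iSup_le fun t => h _ ⟨x, hx, t, rfl⟩⟩
    · exact fun _ _ h => iSup₂_mono fun x _ => Skorohod.modulus_mono x h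
    · obtain ⟨δ, hδ, h⟩ := Skorohod.exists_modulus_le_of_isCompact hK hε
      exact ⟨δ, hδ, iSup₂_le fun x hx => h x (subset_closure hx)⟩
  · rintro ⟨h1, h2, h3⟩
    refine Skorohod.isCompact_closure_of_modulus
      (Skorohod.totallyBounded_of_supNorm_of_modulus (lt_of_le_of_lt ?_ h1) ?_) h3
    · refine iSup₂_le ?_
      rintro _ ⟨x, hx, t, rfl⟩
      exact (le_iSup (fun t : I => Skorohod.supNorm (x t)) t).trans
        (le_iSup₂ (f := fun (x : Skorohod.DD) (_ : x ∈ A) => Skorohod.superNorm x) x hx)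
    · refine tendsto_of_tendsto_of_tendsto_of_le_of_le tendsto_const_nhds h2
        (fun _ => zero_le) fun δ => iSup₂_le ?_
      rintro _ ⟨x, hx, t, rfl⟩
      exact (le_iSup (fun t : I => Skorohod.modulus (x t) δ) t).trans
        (le_iSup₂ (f := fun (x : Skorohod.DD) (_ : x ∈ A) => ⨆ t : I, Skorohod.modulus (x t) δ) x hx)
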